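/- Let $\mathbb H$ be the quaternions, $\mathbb S=\{I\in\mathbb H: I^2=-1\}$ and $L_I=\mathbb R+I\mathbb R$ for $I\in\mathbb S$. For $p,q\in\mathbb H$ put $$\omega(q,p)=\sqrt{[\mathrm{Re}(q)-\mathrm{Re}(p)]^2+[|\mathrm{Im}(q)|+|\mathrm{Im}(p)|]^2},$$ and let $\sigma(q,p)=|q-p|$ if $p,q$ lie on a common complex line $L_I$, and $\sigma(q,p)=\omega(q,p)$ otherwise; $\sigma$ is a distance on $\mathbb H$. For $R\in[0,+\infty]$ let $\Omega(p,R)=\{q:\omega(q,p)<R\}$, $\Sigma(p,R)=\{q:\sigma(q,p)<R\}$ and, if $p\in L_I$, $B_I(p,R)=\{z\in L_I:|z-p|<R\}$. Let $(q-p)^{*n}$ be the $n$-th power of the polynomial $q-p$ with respect to the regular product $\left(\sum q^n a_n\right)*\left(\sum q^n b_n\right)=\sum q^n\sum_{k=0}^n a_kb_{n-k}$. The $\sigma$-radius of convergence of $\sum_{n\in\mathbb N}(q-p)^{*n}a_n$ (with $a_n\in\mathbb H$) is the $R\in[0,+\infty]$ with $1/R=\limsup_{n\to\infty}|a_n|^{1/n}$.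 A function $f$ on a (Euclidean) open set $D\subseteq\mathbb H$ is quaternionic analytic at $s\in D$ if there are $b_n\in\mathbb H$ and a Euclidean neighbourhood $U\subseteq D$ of $s$ such that, for all $q\in U$, the series $\sum_{n}(q-s)^{*n}b_n$ converges with sum $f(q)$. For $T\subseteq\mathbb H$ let $\mathcal A(T)=\{s\in T: 2|\mathrm{Im}(s)|<\sigma(s,\partial_\sigma T)\}$, where $\partial_\sigma T$ is the boundary of $T$ for the topology of $\sigma$ and $\sigma(s,\emptyset)=+\infty$; for $T=B_I(p,R)$, which is considered as a subset of the plane $L_I$, the boundary is the one relative to $L_I$. **Theorem.** Let $p\in\mathbb H$, let $L_I$ be a complex line through $p$, and let $\sum_{n\in\mathbb N}(q-p)^{*n}a_n$ be a regular power series with $\sigma$-radius of convergence $R\in[0,+\infty]$. Suppose that $\Omega(p,R)\neq\emptyset$. Then the series converges absolutely on $\Sigma(p,R)$, $$\mathcal A(\Sigma(p,R))=\mathcal A(\Omega(p,R))\cup\mathcal A(B_I(p,R)),$$ and the sum $f$, as a function on the open set $\Omega(p,R)$, is quaternionic analytic at every point of $\mathcal A(\Sigma(p,R))$. Moreover $\mathcal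 A(\Sigma(p,R))\subseteq\Omega(p,R)$, and $\mathcal A(\Sigma(p,R))$ is open in the Euclidean topology if and only if $p\in\mathbb R$ or $R=+\infty$. -/

import Mathlib

open Filter Topology Quaternion
open scoped ENNReal

noncomputable section

namespace QuatSeries

/-- The sphere `𝕊` of imaginary units: quaternions with square `-1`. -/
def imagUnits : Set ℍ[ℝ] := {I | I ^ 2 = -1}

/-- The complex line `L_I = ℝ + Iℝ`. -/
def complexLine (I : ℍ[ℝ]) : Set ℍ[ℝ] :=
  {q | ∃ x y : ℝ, q = (x : ℍ[ℝ]) + I * (y : ℍ[ℝ])}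

/-- `p` and `q` lie on a common complex line. -/
def OnSameLine (q p : ℍ[ℝ]) : Prop :=
  ∃ I ∈ imagUnits, q ∈ complexLine I ∧ p ∈ complexLine I

/-- `ω(q,p)`; here `q.im` is the imaginary part, as a quaternion. -/
def omega (q p : ℍ[ℝ]) : ℝ :=
  Real.sqrt ((q.re - p.re) ^ 2 + (‖q.im‖ + ‖p.im‖) ^ 2)

open Classical in
/-- The distance `σ(q,p)`. -/
def sigma (q p : ℍ[ℝ]) : ℝ :=
  if OnSameLine q p then ‖q - p‖ else omega q p

/-- The ball `Ω(p,R) = {q : ω(q,p) < R}`, with `R ∈ [0,∞]`. -/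
def omegaBall (p : ℍ[ℝ]) (R : ℝ≥0∞) : Set ℍ[ℝ] :=
  {q | ENNReal.ofReal (omega q p) < R}

/-- The ball `Σ(p,R) = {q : σ(q,p) < R}`, with `R ∈ [0,∞]`. -/
def sigmaBall (p : ℍ[ℝ]) (R : ℝ≥0∞) : Set ℍ[ℝ] :=
  {q | ENNReal.ofReal (sigma q p) < R}

/-- The disc `B_I(p,R) = {z ∈ L_I : |z - p| < R}`, with `R ∈ [0,∞]`. -/
def lineBall (I p : ℍ[ℝ]) (R : ℝ≥0∞) : Set ℍ[ℝ] :=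
  {z | z ∈ complexLine I ∧ ENNReal.ofReal ‖z - p‖ < R}

/-- The regular power `(q - p)^{*n}`. The polynomial ring over the quaternions (whose variable
commutes with the coefficients) carries the regular product
`(∑ q^n a_n) * (∑ q^n b_n) = ∑ q^n ∑_k a_k b_{n-k}`; the `n`-th power is taken there, and then
evaluated at `q` with the coefficients on the right. -/
def starPow (p : ℍ[ℝ]) (n : ℕ) (q : ℍ[ℝ]) : ℍ[ℝ] :=
  (((Polynomial.X : Polynomial ℍ[ℝ]) - Polynomial.C p) ^ n).sum fun k c => q ^ k * c

/-- The sum of the regular power series `∑ (q - p)^{*n} a_n` centered at `p`. -/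
def seriesSum (p : ℍ[ℝ]) (a : ℕ → ℍ[ℝ]) (q : ℍ[ℝ]) : ℍ[ℝ] :=
  ∑' n, starPow p n q * a n

/-- The `σ`-radius of convergence `R ∈ [0,∞]`, with `1/R = limsup |a_n|^{1/n}`. -/
def sigmaRadius (a : ℕ → ℍ[ℝ]) : ℝ≥0∞ :=
  (limsup (fun n : ℕ => (ENNReal.ofReal ‖a n‖) ^ ((1 : ℝ) / (n : ℝ))) atTop)⁻¹

/-- The boundary of `T ⊆ X` in the subspace `X` of the metric space `(ℍ, σ)`: the points of `X`
all of whose `σ`-balls meet both `T` and `X \ T`. -/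
def sigmaBoundary (X T : Set ℍ[ℝ]) : Set ℍ[ℝ] :=
  {q | q ∈ X ∧ ∀ ε : ℝ, 0 < ε →
    (∃ t ∈ T, sigma t q < ε) ∧ (∃ t ∈ X \ T, sigma t q < ε)}

/-- The `σ`-distance from `s` to the set `S`; it is `∞` if `S` is empty. -/
def sigmaInfDist (s : ℍ[ℝ]) (S : Set ℍ[ℝ]) : ℝ≥0∞ :=
  ⨅ t ∈ S, ENNReal.ofReal (sigma s t)

/-- `𝒜(T) = {s ∈ T : 2 |Im s| < σ(s, ∂_σ T)}`, the boundary of `T` being taken in the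
ambient set `X` (all of `ℍ`, or a complex line for subsets of that line). -/
def analyticSet (X T : Set ℍ[ℝ]) : Set ℍ[ℝ] :=
  {s | s ∈ T ∧ ENNReal.ofReal (2 * ‖s.im‖) < sigmaInfDist s (sigmaBoundary X T)}

/-- `f`, defined on the (open) set `D`, is quaternionic analytic at `s`: on some Euclidean
neighbourhood `U` of `s` in `D`, `f` is the sum of a convergent regular power series
centered at `s`. -/
def QuaternionicAnalyticAt (f : ℍ[ℝ] → ℍ[ℝ]) (D : Set ℍ[ℝ]) (s : ℍ[ℝ]) : Prop :=
  ∃ b : ℕ → ℍ[ℝ], ∃ U ∈ 𝓝 s, U ⊆ D ∧ ∀ q ∈ U, HasSum (fun n => starPow s n q * b n) (f q)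

end QuatSeries

end

noncomputable section

namespace QuatSeries

/-! ### Regular powers -/

lemma starPow_zero (p q : ℍ[ℝ]) : starPow p 0 q = 1 := by
  have h : (1 : Polynomial ℍ[ℝ]) = Polynomial.C 1 := by simp
  rw [starPow, pow_zero, h, Polynomial.sum_C_index (by simp)]
  simp

lemma evalRight_mul_X_sub_C (P : Polynomial ℍ[ℝ]) (p q : ℍ[ℝ]) :
    (P * (Polynomial.X - Polynomial.C p)).sum (fun k c => q ^ k * c) =
      q * P.sum (fun k c => q ^ k * c) - P.sum (fun k c => q ^ k * c) * p := by
  have hadd : ∀ A B : Polynomial ℍ[ℝ], (A + B).sum (fun k c => q ^ k * c) =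
      A.sum (fun k c => q ^ k * c) + B.sum (fun k c => q ^ k * c) := fun A B =>
    Polynomial.sum_add_index A B _ (by simp) (fun _ _ _ => mul_add _ _ _)
  induction P using Polynomial.induction_on' with
  | add A B hA hB => rw [add_mul, hadd, hA, hB, hadd]; noncomm_ring
  | monomial n c =>
    rw [mul_sub, sub_eq_add_neg, hadd, Polynomial.monomial_mul_X, ← mul_neg, ← Polynomial.C_neg,
      Polynomial.monomial_mul_C, Polynomial.sum_monomial_index _ _ (by simp),
      Polynomial.sum_monomial_index _ _ (by simp), Polynomial.sum_monomial_index _ _ (by simp),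
      pow_succ']
    noncomm_ring

lemma starPow_succ (p q : ℍ[ℝ]) (n : ℕ) :
    starPow p (n + 1) q = q * starPow p n q - starPow p n q * p := by
  rw [starPow, pow_succ, evalRight_mul_X_sub_C]; rfl

lemma starPow_of_commute {p q : ℍ[ℝ]} (h : Commute q p) (n : ℕ) :
    starPow p n q = (q - p) ^ n := by
  induction n with
  | zero => simp [starPow_zero]
  | succ n ih =>
    have h' : Commute ((q - p) ^ n) p := (h.sub_left (Commute.refl p)).pow_left n
    rw [starPow_succ, ih, h'.eq, pow_succ', sub_mul]

/-- Taylor expansion of a regular power about another centre. -/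
lemma starPow_taylor (p s q : ℍ[ℝ]) (n : ℕ) :
    starPow p n q = ∑ ij ∈ Finset.HasAntidiagonal.antidiagonal n,
      (n.choose ij.1 : ℍ[ℝ]) * (starPow s ij.1 q * starPow p ij.2 s) := by
  induction n with
  | zero => simp [starPow_zero]
  | succ n ih =>
    rw [Finset.sum_antidiagonal_choose_succ_mul fun i j => starPow s i q * starPow p j s,
      starPow_succ, ih, Finset.mul_sum, Finset.sum_mul, ← Finset.sum_sub_distrib,
      ← Finset.sum_add_distrib]
    refine Finset.sum_congr rfl fun ij hij => ?_
    rw [Nat.choose_symm_of_eq_add (Finset.HasAntidiagonal.mem_antidiagonal.1 hij).symm, starPow_succ, starPow_succ,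
      ← mul_assoc q, ← (Nat.cast_commute (n.choose ij.2) q).eq]
    noncomm_ring

lemma starPow_eq_of_intertwine {p q z w E F : ℍ[ℝ]} (hE : q * E = E * z) (hF : q * F = F * w)
    (hEF : E + F = 1) (hz : Commute z p) (hw : Commute w p) (n : ℕ) :
    starPow p n q = E * (z - p) ^ n + F * (w - p) ^ n := by
  induction n with
  | zero => simp [starPow_zero, hEF]
  | succ n ih =>
    have hz' : Commute ((z - p) ^ n) p := (hz.sub_left (Commute.refl p)).pow_left n
    have hw' : Commute ((w - p) ^ n) p := (hw.sub_left (Commute.refl p)).pow_left n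
    rw [starPow_succ, ih, mul_add, add_mul, ← mul_assoc, ← mul_assoc, hE, hF, mul_assoc E _ p,
      mul_assoc F _ p, hz'.eq, hw'.eq, pow_succ', pow_succ']
    noncomm_ring

/-! ### Imaginary units and complex lines -/

lemma imagUnits_re {I : ℍ[ℝ]} (hI : I ∈ imagUnits) : I.re = 0 := by
  have h : I * I = -1 := by rw [← sq]; exact hI
  have h0 := congrArg (fun q : ℍ[ℝ] => q.re) h
  have h1 := congrArg (fun q : ℍ[ℝ] => q.imI) h
  have h2 := congrArg (fun q : ℍ[ℝ] => q.imJ) h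
  have h3 := congrArg (fun q : ℍ[ℝ] => q.imK) h
  simp at h0 h1 h2 h3
  by_contra hne
  have e1 : I.imI = 0 := by
    have : I.re * I.imI = 0 := by linarith
    exact (mul_eq_zero.1 this).resolve_left hne
  have e2 : I.imJ = 0 := by
    have : I.re * I.imJ = 0 := by rw [e1] at h2; linarith
    exact (mul_eq_zero.1 this).resolve_left hne
  have e3 : I.imK = 0 := by
    have : I.re * I.imK = 0 := by rw [e1, e2] at h3; linarith
    exact (mul_eq_zero.1 this).resolve_left hne
  rw [e1, e2, e3] at h0
  nlinarith [mul_self_nonneg I.re]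

lemma imagUnits_norm {I : ℍ[ℝ]} (hI : I ∈ imagUnits) : ‖I‖ = 1 := by
  have h : ‖I‖ ^ 2 = 1 := by rw [← norm_pow, show I ^ 2 = -1 from hI]; simp
  exact (pow_eq_one_iff_of_nonneg (norm_nonneg _) two_ne_zero).1 h

lemma imagUnits_mul_self {I : ℍ[ℝ]} (hI : I ∈ imagUnits) : I * I = -1 := by
  rw [← sq]; exact hI

lemma norm_sq_eq (q : ℍ[ℝ]) : ‖q‖ ^ 2 = q.re ^ 2 + ‖q.im‖ ^ 2 := by
  rw [sq ‖q‖, sq ‖q.im‖, ← Quaternion.normSq_eq_norm_mul_self,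
    ← Quaternion.normSq_eq_norm_mul_self, Quaternion.normSq_def', Quaternion.normSq_def']
  simp; ring

/-- The point `x + I y` of `L_I`. -/
def linePt (I : ℍ[ℝ]) (x y : ℝ) : ℍ[ℝ] := (x : ℍ[ℝ]) + I * (y : ℍ[ℝ])

lemma linePt_mem (I : ℍ[ℝ]) (x y : ℝ) : linePt I x y ∈ complexLine I := ⟨x, y, rfl⟩

lemma linePt_re {I : ℍ[ℝ]} (hI : I ∈ imagUnits) (x y : ℝ) : (linePt I x y).re = x := by
  simp [linePt, imagUnits_re hI]

lemma linePt_im {I : ℍ[ℝ]} (hI : I ∈ imagUnits) (x y : ℝ) :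
    (linePt I x y).im = I * (y : ℍ[ℝ]) := by
  ext <;> simp [linePt, imagUnits_re hI]

lemma linePt_norm_im {I : ℍ[ℝ]} (hI : I ∈ imagUnits) (x y : ℝ) :
    ‖(linePt I x y).im‖ = |y| := by
  rw [linePt_im hI, norm_mul, imagUnits_norm hI, one_mul, Quaternion.norm_coe, Real.norm_eq_abs]

lemma linePt_sub (I : ℍ[ℝ]) (x y x' y' : ℝ) :
    linePt I x y - linePt I x' y' = linePt I (x - x') (y - y') := by
  simp only [linePt, Quaternion.coe_sub]; noncomm_ring

lemma linePt_norm {I : ℍ[ℝ]} (hI : I ∈ imagUnits) (x y : ℝ) :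
    ‖linePt I x y‖ = √(x ^ 2 + y ^ 2) := by
  rw [← Real.sqrt_sq (norm_nonneg (linePt I x y)), norm_sq_eq, linePt_re hI, linePt_norm_im hI,
    sq_abs]

lemma linePt_commute (I : ℍ[ℝ]) (x y x' y' : ℝ) : Commute (linePt I x y) (linePt I x' y') := by
  have h1 : ∀ (r : ℝ) (q : ℍ[ℝ]), Commute (r : ℍ[ℝ]) q := fun r q => Quaternion.coe_commute r q
  have h2 : Commute I (linePt I x' y') :=
    (h1 x' I).symm.add_right ((Commute.refl I).mul_right (h1 y' I).symm)
  exact (h1 x _).add_left (h2.mul_left (h1 y _))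

lemma exists_components (a b c d : ℝ) :
    ∃ q : ℍ[ℝ], q.re = a ∧ q.imI = b ∧ q.imJ = c ∧ q.imK = d :=
  ⟨⟨a, b, c, d⟩, rfl, rfl, rfl, rfl⟩

lemma exists_imagUnit : ∃ I : ℍ[ℝ], I ∈ imagUnits := by
  obtain ⟨I, h0, h1, h2, h3⟩ := exists_components 0 1 0 0
  refine ⟨I, ?_⟩
  change I ^ 2 = _
  rw [sq]
  ext <;> simp [h0, h1, h2, h3]

lemma exists_eq_linePt (q : ℍ[ℝ]) : ∃ J ∈ imagUnits, q = linePt J q.re ‖q.im‖ := by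
  by_cases h : q.im = 0
  · obtain ⟨I, hI⟩ := exists_imagUnit
    refine ⟨I, hI, ?_⟩
    rw [h, norm_zero, linePt]
    nth_rewrite 1 [← Quaternion.re_add_im q]
    simp [h]
  · have hn : ‖q.im‖ ≠ 0 := norm_ne_zero_iff.2 h
    refine ⟨q.im * ((‖q.im‖⁻¹ : ℝ) : ℍ[ℝ]), ?_, ?_⟩
    · change _ ^ 2 = _
      rw [(Quaternion.coe_commute ‖q.im‖⁻¹ q.im).symm.mul_pow]
      have : q.im ^ 2 = -((‖q.im‖ ^ 2 : ℝ) : ℍ[ℝ]) := by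
        rw [Quaternion.im_sq, sq, Quaternion.normSq_eq_norm_mul_self]
      rw [this, ← Quaternion.coe_pow, neg_mul, ← Quaternion.coe_mul]
      simp [hn]
    · rw [linePt, mul_assoc, ← Quaternion.coe_mul, inv_mul_cancel₀ hn, Quaternion.coe_one, mul_one,
        Quaternion.re_add_im]

lemma mem_complexLine_iff {I : ℍ[ℝ]} {q : ℍ[ℝ]} :
    q ∈ complexLine I ↔ ∃ x y, q = linePt I x y := Iff.rfl

lemma complexLine_subset {I J s : ℍ[ℝ]} (hI : I ∈ imagUnits) (hJ : J ∈ imagUnits)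
    (hsI : s ∈ complexLine I) (hsJ : s ∈ complexLine J) (hs : s.im ≠ 0) :
    complexLine I ⊆ complexLine J := by
  obtain ⟨x, y, rfl⟩ := mem_complexLine_iff.1 hsI
  obtain ⟨x', y', h⟩ := mem_complexLine_iff.1 hsJ
  have hy : y ≠ 0 := by rintro rfl; exact hs (by rw [linePt_im hI]; simp)
  have him : I * (y : ℍ[ℝ]) = J * (y' : ℍ[ℝ]) := by rw [← linePt_im hI x, h, linePt_im hJ]
  have hIJ : I = J * ((y' / y : ℝ) : ℍ[ℝ]) := by
    rw [div_eq_mul_inv, Quaternion.coe_mul, ← mul_assoc, ← him, mul_assoc, ← Quaternion.coe_mul,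
      mul_inv_cancel₀ hy, Quaternion.coe_one, mul_one]
  rintro q ⟨u, v, rfl⟩
  refine ⟨u, y' / y * v, ?_⟩
  rw [Quaternion.coe_mul, ← mul_assoc, ← hIJ]

lemma onSameLine_comm {p q : ℍ[ℝ]} : OnSameLine q p ↔ OnSameLine p q := by
  simp only [OnSameLine, and_comm]

lemma OnSameLine.commute {p q : ℍ[ℝ]} (h : OnSameLine q p) : Commute q p := by
  obtain ⟨I, -, ⟨x, y, rfl⟩, ⟨x', y', rfl⟩⟩ := h
  exact linePt_commute I x y x' y'

lemma onSameLine_of_im_eq_zero {p q : ℍ[ℝ]} (h : p.im = 0) : OnSameLine q p := by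
  obtain ⟨J, hJ, hq⟩ := exists_eq_linePt q
  refine ⟨J, hJ, ⟨_, _, hq⟩, ⟨p.re, 0, ?_⟩⟩
  nth_rewrite 1 [← Quaternion.re_add_im p]
  simp [h]

lemma OnSameLine.trans {p q s : ℍ[ℝ]} (h1 : OnSameLine q s) (h2 : OnSameLine s p)
    (hs : s.im ≠ 0) : OnSameLine q p := by
  obtain ⟨I, hI, hq, hsI⟩ := h1
  obtain ⟨J, hJ, hsJ, hp⟩ := h2
  exact ⟨J, hJ, complexLine_subset hI hJ hsI hsJ hs hq, hp⟩

lemma OnSameLine.mem {I p s : ℍ[ℝ]} (hI : I ∈ imagUnits) (hp : p ∈ complexLine I)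
    (hp0 : p.im ≠ 0) (h : OnSameLine s p) : s ∈ complexLine I := by
  obtain ⟨J, hJ, hs, hpJ⟩ := h
  exact complexLine_subset hJ hI hpJ hp hp0 hs

/-! ### The functions `ω` and `σ` -/

/-- Distance of the orbits of `q` and `p` under rotations of the imaginary part. -/
def orbitDist (q p : ℍ[ℝ]) : ℝ := √((q.re - p.re) ^ 2 + (‖q.im‖ - ‖p.im‖) ^ 2)

lemma sqrt_triangle (a b c d : ℝ) :
    √((a + c) ^ 2 + (b + d) ^ 2) ≤ √(a ^ 2 + b ^ 2) + √(c ^ 2 + d ^ 2) := by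
  have h := norm_add_le (⟨a, b⟩ : ℂ) ⟨c, d⟩
  simpa only [Complex.norm_eq_sqrt_sq_add_sq, Complex.add_re, Complex.add_im] using h

lemma omega_nonneg (q p : ℍ[ℝ]) : 0 ≤ omega q p := Real.sqrt_nonneg _

lemma omega_comm (q p : ℍ[ℝ]) : omega q p = omega p q := by
  unfold omega; congr 1; ring

lemma omega_self (q : ℍ[ℝ]) : omega q q = 2 * ‖q.im‖ := by
  rw [omega, sub_self, ← two_mul, zero_pow two_ne_zero, zero_add, Real.sqrt_sq (by positivity)]

lemma orbitDist_comm (q p : ℍ[ℝ]) : orbitDist q p = orbitDist p q := by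
  unfold orbitDist; congr 1; ring

lemma orbitDist_le_omega (q p : ℍ[ℝ]) : orbitDist q p ≤ omega q p := by
  refine Real.sqrt_le_sqrt ?_
  nlinarith [mul_nonneg (norm_nonneg q.im) (norm_nonneg p.im)]

lemma norm_eq_sqrt (q : ℍ[ℝ]) : ‖q‖ = √(q.re ^ 2 + ‖q.im‖ ^ 2) := by
  rw [← norm_sq_eq, Real.sqrt_sq (norm_nonneg _)]

lemma im_sub' (q p : ℍ[ℝ]) : (q - p).im = q.im - p.im := by ext <;> simp

lemma norm_sub_le_omega (q p : ℍ[ℝ]) : ‖q - p‖ ≤ omega q p := by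
  rw [norm_eq_sqrt, im_sub', Quaternion.re_sub]
  refine Real.sqrt_le_sqrt ?_
  gcongr
  exact norm_sub_le _ _

lemma orbitDist_le_norm_sub (q p : ℍ[ℝ]) : orbitDist q p ≤ ‖q - p‖ := by
  rw [norm_eq_sqrt, im_sub', Quaternion.re_sub]
  refine Real.sqrt_le_sqrt (add_le_add le_rfl ?_)
  rw [sq_le_sq, abs_of_nonneg (norm_nonneg (q.im - p.im))]
  exact abs_norm_sub_norm_le _ _

lemma omega_le_orbitDist_add (t s p : ℍ[ℝ]) : omega t p ≤ orbitDist t s + omega s p := by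
  have h := sqrt_triangle (t.re - s.re) (‖t.im‖ - ‖s.im‖) (s.re - p.re) (‖s.im‖ + ‖p.im‖)
  have e1 : t.re - s.re + (s.re - p.re) = t.re - p.re := by ring
  have e2 : ‖t.im‖ - ‖s.im‖ + (‖s.im‖ + ‖p.im‖) = ‖t.im‖ + ‖p.im‖ := by ring
  rwa [e1, e2] at h

lemma omega_of_im_eq_zero {p : ℍ[ℝ]} (hp : p.im = 0) (q : ℍ[ℝ]) : omega q p = ‖q - p‖ := by
  rw [norm_eq_sqrt, im_sub', Quaternion.re_sub, omega, hp]; simp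

lemma omega_le_norm_sub_add (s p : ℍ[ℝ]) : omega s p ≤ ‖s - p‖ + 2 * ‖s.im‖ := by
  rw [omega_comm, ← omega_self]
  exact (omega_le_orbitDist_add p s s).trans
    (by rw [orbitDist_comm]; gcongr; exact orbitDist_le_norm_sub s p)

lemma continuous_omega (p : ℍ[ℝ]) : Continuous fun q => omega q p := by
  have h : Continuous fun q : ℍ[ℝ] => q.im := Quaternion.continuous_im
  have h' : Continuous fun q : ℍ[ℝ] => q.re := Quaternion.continuous_re
  unfold omega
  fun_prop

lemma sigma_of_onSameLine {q p : ℍ[ℝ]} (h : OnSameLine q p) : sigma q p = ‖q - p‖ := if_pos h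

lemma sigma_of_not_onSameLine {q p : ℍ[ℝ]} (h : ¬ OnSameLine q p) : sigma q p = omega q p :=
  if_neg h

lemma sigma_of_mem {I q p : ℍ[ℝ]} (hI : I ∈ imagUnits) (hq : q ∈ complexLine I)
    (hp : p ∈ complexLine I) : sigma q p = ‖q - p‖ :=
  sigma_of_onSameLine ⟨I, hI, hq, hp⟩

lemma sigma_comm (q p : ℍ[ℝ]) : sigma q p = sigma p q := by
  by_cases h : OnSameLine q p
  · rw [sigma_of_onSameLine h, sigma_of_onSameLine (onSameLine_comm.1 h), norm_sub_rev]
  · rw [sigma_of_not_onSameLine h, sigma_of_not_onSameLine (mt onSameLine_comm.1 h), omega_comm]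

lemma sigma_of_im_eq_zero {p : ℍ[ℝ]} (hp : p.im = 0) (q : ℍ[ℝ]) : sigma q p = omega q p := by
  rw [sigma_of_onSameLine (onSameLine_of_im_eq_zero hp), omega_of_im_eq_zero hp]

lemma sigma_of_not_mem {I p s : ℍ[ℝ]} (hI : I ∈ imagUnits) (hp : p ∈ complexLine I)
    (hs : s ∉ complexLine I) : sigma s p = omega s p := by
  by_cases hp0 : p.im = 0
  · exact sigma_of_im_eq_zero hp0 s
  · exact sigma_of_not_onSameLine fun h => hs (h.mem hI hp hp0)

lemma norm_sub_le_sigma (q p : ℍ[ℝ]) : ‖q - p‖ ≤ sigma q p := by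
  by_cases h : OnSameLine q p
  · rw [sigma_of_onSameLine h]
  · rw [sigma_of_not_onSameLine h]; exact norm_sub_le_omega q p

lemma sigma_le_omega (q p : ℍ[ℝ]) : sigma q p ≤ omega q p := by
  by_cases h : OnSameLine q p
  · rw [sigma_of_onSameLine h]; exact norm_sub_le_omega q p
  · rw [sigma_of_not_onSameLine h]

lemma sigma_nonneg (q p : ℍ[ℝ]) : 0 ≤ sigma q p := (norm_nonneg _).trans (norm_sub_le_sigma q p)

lemma omega_le_sigma_add (t s p : ℍ[ℝ]) : omega t p ≤ sigma t s + omega s p :=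
  (omega_le_orbitDist_add t s p).trans <| by
    gcongr; exact (orbitDist_le_norm_sub t s).trans (norm_sub_le_sigma t s)

lemma sigma_triangle (t s p : ℍ[ℝ]) : sigma t p ≤ sigma t s + sigma s p := by
  by_cases h : OnSameLine t p
  · rw [sigma_of_onSameLine h]
    exact (norm_sub_le_norm_sub_add_norm_sub t s p).trans
      (add_le_add (norm_sub_le_sigma t s) (norm_sub_le_sigma s p))
  · rw [sigma_of_not_onSameLine h]
    have key : sigma s p = omega s p ∨ sigma t s = omega t s := by
      by_cases hs : s.im = 0
      · exact Or.inr (sigma_of_im_eq_zero hs t)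
      by_cases h1 : OnSameLine s p
      · exact Or.inr (sigma_of_not_onSameLine fun h2 => h (h2.trans h1 hs))
      · exact Or.inl (sigma_of_not_onSameLine h1)
    rcases key with h1 | h1
    · rw [h1]; exact omega_le_sigma_add t s p
    · rw [h1, add_comm, omega_comm t p, sigma_comm s p, omega_comm t s]
      exact omega_le_sigma_add p s t

lemma norm_starPow_le (p q : ℍ[ℝ]) (n : ℕ) : ‖starPow p n q‖ ≤ 2 * sigma q p ^ n := by
  by_cases h : OnSameLine q p
  · rw [sigma_of_onSameLine h, starPow_of_commute h.commute, norm_pow]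
    have := pow_nonneg (norm_nonneg (q - p)) n
    linarith
  rw [sigma_of_not_onSameLine h]
  obtain ⟨J, hJ, hq⟩ := exists_eq_linePt q
  obtain ⟨I, hI, hp⟩ := exists_eq_linePt p
  set u := q.re
  set v := ‖q.im‖
  have hII := imagUnits_mul_self hI
  have hJJ := imagUnits_mul_self hJ
  have hu := fun x : ℍ[ℝ] => (Quaternion.coe_commute u x).eq
  have hv := fun x : ℍ[ℝ] => (Quaternion.coe_commute v x).eq
  have hz : Commute (linePt I u v) p := by rw [hp]; exact linePt_commute ..
  have hw : Commute (linePt I u (-v)) p := by rw [hp]; exact linePt_commute ..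
  set E : ℍ[ℝ] := ((1 / 2 : ℝ) : ℍ[ℝ]) * (1 - J * I)
  set F : ℍ[ℝ] := ((1 / 2 : ℝ) : ℍ[ℝ]) * (1 + J * I)
  have hJI : ‖J * I‖ = 1 := by rw [norm_mul, imagUnits_norm hI, imagUnits_norm hJ, one_mul]
  have hEn : ‖E‖ ≤ 1 := by
    rw [norm_mul, Quaternion.norm_coe]
    have := norm_sub_le 1 (J * I)
    rw [hJI, norm_one] at this
    norm_num at this ⊢; linarith
  have hFn : ‖F‖ ≤ 1 := by
    rw [norm_mul, Quaternion.norm_coe]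
    have := norm_add_le 1 (J * I)
    rw [hJI, norm_one] at this
    norm_num at this ⊢; linarith
  have hEF : E + F = 1 := by
    rw [← mul_add, show (1 - J * I) + (1 + J * I) = ((2 : ℝ) : ℍ[ℝ]) by
        ext <;> (simp; try norm_num),
      ← Quaternion.coe_mul]
    norm_num
  have aux1 : linePt J u v * (1 - J * I) = (1 - J * I) * linePt I u v := by
    simp only [linePt, ← hv]
    have e1 : (1 - J * I) * (↑u + ↑v * I) = ↑u * (1 - J * I) + v * (I - J * (I * I)) := by
      rw [mul_add, ← hu, ← mul_assoc, ← hv]; noncomm_ring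
    have e2 : (↑u + ↑v * J) * (1 - J * I) = ↑u * (1 - J * I) + v * (J - (J * J) * I) := by
      noncomm_ring
    rw [e1, e2, hII, hJJ]; noncomm_ring
  have aux2 : linePt J u v * (1 + J * I) = (1 + J * I) * linePt I u (-v) := by
    simp only [linePt, Quaternion.coe_neg, mul_neg, ← hv]
    have e1 : (1 + J * I) * (↑u + -(↑v * I)) = ↑u * (1 + J * I) - v * (I + J * (I * I)) := by
      rw [mul_add, ← hu, mul_neg, ← mul_assoc, ← hv]; noncomm_ring
    have e2 : (↑u + ↑v * J) * (1 + J * I) = ↑u * (1 + J * I) + v * (J + (J * J) * I) := by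
      noncomm_ring
    rw [e1, e2, hII, hJJ]; noncomm_ring
  have hE : q * E = E * linePt I u v := by
    rw [← mul_assoc, ← (Quaternion.coe_commute (1 / 2) q).eq, mul_assoc, mul_assoc, ← aux1, ← hq]
  have hF : q * F = F * linePt I u (-v) := by
    rw [← mul_assoc, ← (Quaternion.coe_commute (1 / 2) q).eq, mul_assoc, mul_assoc, ← aux2, ← hq]
  have nz : ‖linePt I u v - p‖ ≤ omega q p := by
    refine (le_of_eq ?_).trans (orbitDist_le_omega q p)
    nth_rewrite 1 [hp]
    rw [linePt_sub, linePt_norm hI]; rfl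
  have nw : ‖linePt I u (-v) - p‖ ≤ omega q p := by
    refine le_of_eq ?_
    nth_rewrite 1 [hp]
    rw [linePt_sub, linePt_norm hI, omega]; congr 1; ring
  rw [starPow_eq_of_intertwine hE hF hEF hz hw, two_mul]
  refine (norm_add_le _ _).trans (add_le_add ?_ ?_)
  · rw [norm_mul, norm_pow, ← one_mul (omega q p ^ n)]; gcongr
  · rw [norm_mul, norm_pow, ← one_mul (omega q p ^ n)]; gcongr

/-! ### Convergence and change of centre -/

lemma summable_norm_mul_pow {a : ℕ → ℍ[ℝ]} {r : ℝ} (hr : 0 ≤ r)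
    (h : ENNReal.ofReal r < sigmaRadius a) : Summable fun n => ‖a n‖ * r ^ n := by
  obtain ⟨c, hrc, hc⟩ := exists_between h
  have hctop : c ≠ ⊤ := (hc.trans_le le_top).ne
  have hc0 : c ≠ 0 := (zero_le.trans_lt hrc).ne'
  set t : ℝ := c.toReal
  have ht : 0 < t := ENNReal.toReal_pos hc0 hctop
  have hrt : r < t := by
    rwa [← ENNReal.ofReal_toReal hctop, ENNReal.ofReal_lt_ofReal_iff ht] at hrc
  have hlim : limsup (fun n : ℕ => ENNReal.ofReal ‖a n‖ ^ ((1 : ℝ) / (n : ℝ))) atTop < c⁻¹ := by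
    rw [sigmaRadius] at hc
    exact ENNReal.lt_inv_iff_lt_inv.1 hc
  have hev := eventually_lt_of_limsup_lt hlim
  have hb : ∀ᶠ n : ℕ in atTop, ‖a n‖ * t ^ n ≤ 1 := by
    filter_upwards [hev, eventually_gt_atTop 0] with n hn hn0
    have hn0' : (n : ℝ) ≠ 0 := by exact_mod_cast hn0.ne'
    have h1 : ENNReal.ofReal ‖a n‖ ≤ (c⁻¹) ^ n := by
      calc ENNReal.ofReal ‖a n‖
          = (ENNReal.ofReal ‖a n‖ ^ ((1 : ℝ) / (n : ℝ))) ^ n := by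
            rw [← ENNReal.rpow_natCast, ← ENNReal.rpow_mul, one_div_mul_cancel hn0',
              ENNReal.rpow_one]
        _ ≤ (c⁻¹) ^ n := by gcongr
    have h2 : ‖a n‖ ≤ (t⁻¹) ^ n := by
      have := ENNReal.toReal_mono (ENNReal.pow_ne_top (ENNReal.inv_ne_top.2 hc0)) h1
      rwa [ENNReal.toReal_ofReal (norm_nonneg _), ENNReal.toReal_pow, ENNReal.toReal_inv] at this
    calc ‖a n‖ * t ^ n ≤ (t⁻¹) ^ n * t ^ n := by gcongr
      _ = 1 := by rw [← mul_pow, inv_mul_cancel₀ ht.ne', one_pow]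
  have hgeo : Summable fun n : ℕ => (r / t) ^ n :=
    summable_geometric_of_lt_one (by positivity) ((div_lt_one ht).2 hrt)
  refine summable_of_isBigO_nat hgeo (Asymptotics.IsBigO.of_bound 1 ?_)
  filter_upwards [hb] with n hn
  rw [Real.norm_of_nonneg (by positivity), Real.norm_of_nonneg (by positivity), one_mul]
  calc ‖a n‖ * r ^ n = (‖a n‖ * t ^ n) * (r / t) ^ n := by
        rw [div_pow]; field_simp
    _ ≤ 1 * (r / t) ^ n := by gcongr
    _ = _ := one_mul _

lemma summable_starPow {p q : ℍ[ℝ]} {a : ℕ → ℍ[ℝ]}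
    (h : ENNReal.ofReal (sigma q p) < sigmaRadius a) :
    Summable fun n => ‖starPow p n q * a n‖ := by
  refine Summable.of_nonneg_of_le (fun _ => norm_nonneg _) (fun n => ?_)
    ((summable_norm_mul_pow (sigma_nonneg q p) h).mul_left 2)
  rw [norm_mul]
  calc ‖starPow p n q‖ * ‖a n‖ ≤ (2 * sigma q p ^ n) * ‖a n‖ := by
        gcongr; exact norm_starPow_le p q n
    _ = _ := by ring

lemma hasSum_of_hasSum_antidiagonal {g : ℕ × ℕ → ℍ[ℝ]} {S : ℕ → ℍ[ℝ]} {f : ℍ[ℝ]}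
    (hg : Summable g)
    (hS : ∀ n, S n = ∑ ij ∈ Finset.HasAntidiagonal.antidiagonal n, g ij) (hf : HasSum S f) :
    HasSum g f := by
  have h1 := (Finset.HasAntidiagonal.sigmaAntidiagonalEquivProd (A := ℕ)).hasSum_iff.2 hg.hasSum
  have h2 : HasSum S (∑' x, g x) := by
    refine h1.sigma fun n => ?_
    rw [hS]
    exact Finset.hasSum (Finset.HasAntidiagonal.antidiagonal n) g
  rw [hf.unique h2]
  exact hg.hasSum

lemma summable_binomial {c : ℕ → ℝ} (hc : ∀ n, 0 ≤ c n) {x y : ℝ} (hx : 0 ≤ x) (hy : 0 ≤ y)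
    (h : Summable fun n => c n * (x + y) ^ n) :
    Summable fun ij : ℕ × ℕ =>
      ((ij.1 + ij.2).choose ij.1 : ℝ) * (x ^ ij.1 * y ^ ij.2) * c (ij.1 + ij.2) := by
  rw [← (Finset.HasAntidiagonal.sigmaAntidiagonalEquivProd (A := ℕ)).summable_iff,
    summable_sigma_of_nonneg]
  swap
  · exact fun z => mul_nonneg (by positivity) (hc _)
  refine ⟨fun n => Summable.of_finite, h.congr fun n => ?_⟩
  rw [tsum_fintype, (Commute.all x y).add_pow', Finset.mul_sum, ← Finset.sum_coe_sort]
  refine Finset.sum_congr rfl fun ij _ => ?_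
  have hij := Finset.HasAntidiagonal.mem_antidiagonal.1 ij.2
  simp only [Function.comp_apply, Finset.HasAntidiagonal.sigmaAntidiagonalEquivProd_apply, hij, nsmul_eq_mul]
  ring

/-- The sum of a regular power series centered at `p` is, near `s`, the sum of a regular power
series centered at `s`, as long as `ω(q,s) + σ(s,p)` is less than the radius. -/
lemma hasSum_recenter {p s q : ℍ[ℝ]} {a : ℕ → ℍ[ℝ]}
    (h : ENNReal.ofReal (omega q s + sigma s p) < sigmaRadius a) :
    HasSum (fun k => starPow s k q *
      ∑' j, ((k + j).choose k : ℍ[ℝ]) * (starPow p j s * a (k + j))) (seriesSum p a q) := by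
  set g : ℕ × ℕ → ℍ[ℝ] := fun ij => starPow s ij.1 q *
    (((ij.1 + ij.2).choose ij.1 : ℍ[ℝ]) * (starPow p ij.2 s * a (ij.1 + ij.2))) with hgdef
  have hg : Summable g := by
    refine Summable.of_norm_bounded ((summable_binomial (fun n => norm_nonneg (a n))
      (omega_nonneg q s) (sigma_nonneg s p) (summable_norm_mul_pow
        (add_nonneg (omega_nonneg q s) (sigma_nonneg s p)) h)).mul_left 4) fun ij => ?_
    have h1 : ‖starPow s ij.1 q‖ ≤ 2 * omega q s ^ ij.1 :=
      (norm_starPow_le s q ij.1).trans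
        (by gcongr; exacts [sigma_nonneg q s, sigma_le_omega q s])
    have h2 := norm_starPow_le p s ij.2
    have h3 : ‖((ij.1 + ij.2).choose ij.1 : ℍ[ℝ])‖ = ((ij.1 + ij.2).choose ij.1 : ℝ) := by
      rw [← Quaternion.coe_natCast, Quaternion.norm_coe, Real.norm_natCast]
    have h0 := omega_nonneg q s
    have h0' := sigma_nonneg s p
    rw [hgdef, norm_mul, norm_mul, norm_mul, h3]
    calc _ ≤ (2 * omega q s ^ ij.1) * (((ij.1 + ij.2).choose ij.1 : ℝ) *
          ((2 * sigma s p ^ ij.2) * ‖a (ij.1 + ij.2)‖)) := by gcongr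
      _ = _ := by ring
  have hqp : ENNReal.ofReal (sigma q p) < sigmaRadius a :=
    (ENNReal.ofReal_le_ofReal ((sigma_triangle q s p).trans
      (by gcongr; exact sigma_le_omega q s))).trans_lt h
  have hf : HasSum (fun n => starPow p n q * a n) (seriesSum p a q) :=
    (summable_starPow hqp).of_norm.hasSum
  refine (hasSum_of_hasSum_antidiagonal hg (fun n => ?_) hf).prod_fiberwise fun k => ?_
  · rw [starPow_taylor p s q n, Finset.sum_mul]
    refine Finset.sum_congr rfl fun ij hij => ?_
    rw [hgdef]
    simp only [Finset.HasAntidiagonal.mem_antidiagonal.1 hij]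
    rw [(Nat.cast_commute (n.choose ij.1) _).eq, (Nat.cast_commute (n.choose ij.1) _).eq]
    simp only [mul_assoc]
    rw [(Nat.cast_commute (n.choose ij.1) _).eq]
  · rw [← tsum_mul_left]
    exact (hg.prod_factor k).hasSum

lemma continuous_ofReal_omega_add (p : ℍ[ℝ]) (c : ℝ) :
    Continuous fun q => ENNReal.ofReal (omega q p + c) :=
  ENNReal.continuous_ofReal.comp ((continuous_omega p).add continuous_const)

lemma quaternionicAnalyticAt_seriesSum {p s : ℍ[ℝ]} {a : ℕ → ℍ[ℝ]}
    (h : ENNReal.ofReal (2 * ‖s.im‖ + sigma s p) < sigmaRadius a) :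
    QuaternionicAnalyticAt (seriesSum p a) (omegaBall p (sigmaRadius a)) s := by
  refine ⟨_, {q | ENNReal.ofReal (omega q s + sigma s p) < sigmaRadius a} ∩
    omegaBall p (sigmaRadius a), ?_, Set.inter_subset_right, fun q hq => hasSum_recenter hq.1⟩
  refine inter_mem ?_ ?_
  · refine (isOpen_lt (continuous_ofReal_omega_add s _) continuous_const).mem_nhds ?_
    change ENNReal.ofReal (omega s s + sigma s p) < _
    rwa [omega_self]
  · refine (isOpen_lt (by simpa using continuous_ofReal_omega_add p 0)
      continuous_const).mem_nhds ?_
    refine (ENNReal.ofReal_le_ofReal ((omega_le_norm_sub_add s p).trans ?_)).trans_lt h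
    rw [add_comm]; gcongr; exact norm_sub_le_sigma s p

/-! ### The sets `𝒜(T)` -/

/-- Along a ray starting at `s`, the `σ`-distance is the arc length and `d` increases with unit
speed. -/
def IsRay (X : Set ℍ[ℝ]) (d : ℍ[ℝ] → ℝ) (s : ℍ[ℝ]) (γ : ℝ → ℍ[ℝ]) : Prop :=
  γ (d s) = s ∧ (∀ r, d s ≤ r → γ r ∈ X ∧ d (γ r) = r) ∧
    ∀ r r', d s ≤ r → d s ≤ r' → sigma (γ r) (γ r') = |r - r'|

lemma mem_analyticSet_iff {X T : Set ℍ[ℝ]} {d : ℍ[ℝ] → ℝ} {R : ℝ≥0∞} {s : ℍ[ℝ]} {γ : ℝ → ℍ[ℝ]}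
    (hT : T = {q | q ∈ X ∧ ENNReal.ofReal (d q) < R}) (hs : s ∈ X) (hd0 : ∀ q, 0 ≤ d q)
    (hd : ∀ t ∈ X, ∀ q ∈ X, d t ≤ sigma t q + d q) (hγ : IsRay X d s γ) :
    s ∈ analyticSet X T ↔ ENNReal.ofReal (2 * ‖s.im‖ + d s) < R := by
  have hbdry : ∀ t ∈ sigmaBoundary X T, R ≤ ENNReal.ofReal (d t) := by
    rintro t ⟨htX, ht⟩
    by_contra! hlt
    have hc : ∃ ε : ℝ, 0 < ε ∧ ENNReal.ofReal (ε + d t) < R := by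
      have hcont : Tendsto (fun ε : ℝ => ENNReal.ofReal (ε + d t)) (𝓝[>] 0)
          (𝓝 (ENNReal.ofReal (0 + d t))) :=
        ((ENNReal.continuous_ofReal.comp
          (continuous_id.add continuous_const)).tendsto 0).mono_left nhdsWithin_le_nhds
      rw [zero_add] at hcont
      obtain ⟨ε, h1, h2⟩ :=
        ((hcont.eventually (gt_mem_nhds hlt)).and self_mem_nhdsWithin).exists
      exact ⟨ε, h2, h1⟩
    obtain ⟨ε, hε, hεR⟩ := hc
    obtain ⟨-, t', ⟨ht'X, ht'T⟩, ht'⟩ := ht ε hε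
    refine ht'T ?_
    rw [hT]
    refine ⟨ht'X, (ENNReal.ofReal_le_ofReal ?_).trans_lt hεR⟩
    linarith [hd t' ht'X t htX]
  have him := norm_nonneg s.im
  have hds := hd0 s
  constructor
  · rintro ⟨hsT, hlt⟩
    rw [hT] at hsT
    by_cases hRtop : R = ⊤
    · rw [hRtop]; exact ENNReal.ofReal_lt_top
    have hR : R = ENNReal.ofReal R.toReal := (ENNReal.ofReal_toReal hRtop).symm
    set ρ := R.toReal
    have hdρ : d s < ρ := by
      have := hsT.2
      rw [hR] at this
      exact (ENNReal.ofReal_lt_ofReal_iff_of_nonneg hds).1 this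
    have hmem : γ ρ ∈ sigmaBoundary X T := by
      obtain ⟨hX, hdγ⟩ := hγ.2.1 ρ hdρ.le
      refine ⟨hX, fun ε hε => ⟨?_, γ ρ, ⟨hX, ?_⟩, ?_⟩⟩
      · have hm1 : d s ≤ max (d s) (ρ - ε / 2) := le_max_left _ _
        have hm2 : max (d s) (ρ - ε / 2) < ρ := max_lt hdρ (by linarith)
        obtain ⟨hX', hdγ'⟩ := hγ.2.1 _ hm1
        refine ⟨γ (max (d s) (ρ - ε / 2)), ?_, ?_⟩
        · rw [hT]
          refine ⟨hX', ?_⟩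
          rw [hdγ', hR]
          exact (ENNReal.ofReal_lt_ofReal_iff_of_nonneg (hds.trans hm1)).2 hm2
        · rw [hγ.2.2 _ _ hm1 hdρ.le, abs_lt]
          have := le_max_right (d s) (ρ - ε / 2)
          constructor <;> linarith
      · rw [hT]
        rintro ⟨-, h⟩
        rw [hdγ, hR] at h
        exact lt_irrefl _ h
      · rw [hγ.2.2 _ _ hdρ.le hdρ.le]; simpa using hε
    have h1 : ENNReal.ofReal (2 * ‖s.im‖) < ENNReal.ofReal (sigma s (γ ρ)) :=
      hlt.trans_le (iInf₂_le _ hmem)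
    have h2 : sigma s (γ ρ) = ρ - d s := by
      have := hγ.2.2 (d s) ρ le_rfl hdρ.le
      rw [hγ.1, abs_sub_comm, abs_of_pos (by linarith)] at this
      exact this
    rw [h2, ENNReal.ofReal_lt_ofReal_iff_of_nonneg (by positivity)] at h1
    rw [hR]
    exact (ENNReal.ofReal_lt_ofReal_iff_of_nonneg (by positivity)).2 (by linarith)
  · intro h
    refine ⟨?_, ?_⟩
    · rw [hT]
      exact ⟨hs, (ENNReal.ofReal_le_ofReal (by linarith)).trans_lt h⟩
    by_cases hRtop : R = ⊤
    · have : sigmaBoundary X T = ∅ := by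
        refine Set.eq_empty_of_forall_notMem fun t ht => ?_
        have := hbdry t ht
        rw [hRtop] at this
        exact absurd this (not_le.2 ENNReal.ofReal_lt_top)
      simp only [sigmaInfDist, this, Set.mem_empty_iff_false, iInf_false, iInf_top]
      exact ENNReal.ofReal_lt_top
    have hR : R = ENNReal.ofReal R.toReal := (ENNReal.ofReal_toReal hRtop).symm
    set ρ := R.toReal
    rw [hR, ENNReal.ofReal_lt_ofReal_iff_of_nonneg (by positivity)] at h
    have h1 : ENNReal.ofReal (2 * ‖s.im‖) < ENNReal.ofReal (ρ - d s) :=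
      (ENNReal.ofReal_lt_ofReal_iff_of_nonneg (by positivity)).2 (by linarith)
    refine h1.trans_le (le_iInf₂ fun t ht => ENNReal.ofReal_le_ofReal ?_)
    have h2 := hbdry t ht
    rw [hR, ENNReal.ofReal_le_ofReal_iff (hd0 t)] at h2
    have := hd t ht.1 s hs
    rw [sigma_comm] at this
    linarith

lemma exists_polar (a b : ℝ) : ∃ c e : ℝ, c ^ 2 + e ^ 2 = 1 ∧ √(a ^ 2 + b ^ 2) * c = a ∧
    √(a ^ 2 + b ^ 2) * e = b ∧ (0 ≤ b → 0 ≤ e) := by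
  by_cases h : a ^ 2 + b ^ 2 = 0
  · have ha : a = 0 := by nlinarith [sq_nonneg a, sq_nonneg b]
    have hb : b = 0 := by nlinarith [sq_nonneg a, sq_nonneg b]
    exact ⟨1, 0, by norm_num, by simp [ha, hb], by simp [ha, hb], fun _ => le_rfl⟩
  · have hpos : 0 < a ^ 2 + b ^ 2 := lt_of_le_of_ne (by positivity) (Ne.symm h)
    have hs := Real.sqrt_pos.2 hpos
    refine ⟨a / √(a ^ 2 + b ^ 2), b / √(a ^ 2 + b ^ 2), ?_, by field_simp, by field_simp,
      fun hb => by positivity⟩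
    rw [div_pow, div_pow, Real.sq_sqrt hpos.le]
    field_simp

lemma sqrt_mul_unit {c e : ℝ} (h : c ^ 2 + e ^ 2 = 1) (r : ℝ) :
    √((r * c) ^ 2 + (r * e) ^ 2) = |r| := by
  rw [mul_pow, mul_pow, ← mul_add, h, mul_one, Real.sqrt_sq_eq_abs]

lemma exists_isRay_line {I p s : ℍ[ℝ]} (hI : I ∈ imagUnits) (hp : p ∈ complexLine I)
    (hs : s ∈ complexLine I) : ∃ γ, IsRay (complexLine I) (fun q => ‖q - p‖) s γ := by
  obtain ⟨x, y, rfl⟩ := mem_complexLine_iff.1 hp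
  obtain ⟨u, v, rfl⟩ := mem_complexLine_iff.1 hs
  obtain ⟨c, e, h1, hc, he, -⟩ := exists_polar (u - x) (v - y)
  refine ⟨fun r => linePt I (x + r * c) (y + r * e), ?_, fun r hr => ⟨linePt_mem .., ?_⟩,
    fun r r' _ _ => ?_⟩
  · simp only [linePt_sub, linePt_norm hI, hc, he]
    congr 1 <;> ring
  · have hr0 : 0 ≤ r := (norm_nonneg _).trans hr
    simp only [linePt_sub, linePt_norm hI, add_sub_cancel_left, sqrt_mul_unit h1, abs_of_nonneg hr0]
  · rw [sigma_of_mem hI (linePt_mem ..) (linePt_mem ..), linePt_sub, linePt_norm hI,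
      ← sqrt_mul_unit h1]
    congr 1; ring

lemma exists_isRay_omega (s p : ℍ[ℝ]) : ∃ γ, IsRay Set.univ (fun q => omega q p) s γ ∧
    ∃ J ∈ imagUnits, s ∈ complexLine J ∧
      ∀ r, omega s p ≤ r → γ r ∈ complexLine J ∧ ‖s.im‖ ≤ ‖(γ r).im‖ := by
  obtain ⟨J, hJ, hs⟩ := exists_eq_linePt s
  obtain ⟨c, e, h1, hc, he, hpos⟩ := exists_polar (s.re - p.re) (‖s.im‖ + ‖p.im‖)
  have he0 : 0 ≤ e := hpos (by positivity)
  change omega s p * c = _ at hc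
  change omega s p * e = _ at he
  have hle : ∀ r, omega s p ≤ r → ‖s.im‖ ≤ r * e - ‖p.im‖ := fun r hr => by
    have := mul_le_mul_of_nonneg_right hr he0
    linarith
  have him : ∀ r, omega s p ≤ r →
      ‖(linePt J (p.re + r * c) (r * e - ‖p.im‖)).im‖ = r * e - ‖p.im‖ := fun r hr => by
    rw [linePt_norm_im hJ, abs_of_nonneg ((norm_nonneg _).trans (hle r hr))]
  refine ⟨fun r => linePt J (p.re + r * c) (r * e - ‖p.im‖), ⟨?_, fun r hr => ⟨trivial, ?_⟩,
    fun r r' _ _ => ?_⟩, J, hJ, ⟨_, _, hs⟩, fun r hr => ⟨linePt_mem .., ?_⟩⟩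
  · simp only [hc, he, add_sub_cancel, add_sub_cancel_right]
    exact hs.symm
  · have hr0 : 0 ≤ r := (omega_nonneg s p).trans hr
    simp only [omega]
    rw [him r hr, linePt_re hJ, add_sub_cancel_left, sub_add_cancel, sqrt_mul_unit h1,
      abs_of_nonneg hr0]
  · rw [sigma_of_mem hJ (linePt_mem ..) (linePt_mem ..), linePt_sub, linePt_norm hJ,
      ← sqrt_mul_unit h1]
    congr 1; ring
  · rw [him r hr]; exact hle r hr

lemma exists_isRay_sigma (s p : ℍ[ℝ]) : ∃ γ, IsRay Set.univ (fun q => sigma q p) s γ := by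
  by_cases h : OnSameLine s p
  · obtain ⟨I, hI, hs, hp⟩ := h
    obtain ⟨γ, h0, h1, h2⟩ := exists_isRay_line hI hp hs
    refine ⟨γ, ?_⟩
    simp only [IsRay, sigma_of_mem hI hs hp]
    exact ⟨h0, fun r hr => ⟨trivial, by rw [sigma_of_mem hI (h1 r hr).1 hp]; exact (h1 r hr).2⟩, h2⟩
  · obtain ⟨γ, ⟨h0, h1, h2⟩, J, hJ, hsJ, hγ⟩ := exists_isRay_omega s p
    refine ⟨γ, ?_⟩
    simp only [IsRay, sigma_of_not_onSameLine h]
    refine ⟨h0, fun r hr => ⟨trivial, ?_⟩, h2⟩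
    have hs0 : s.im ≠ 0 := fun hs0 => h (onSameLine_comm.1 (onSameLine_of_im_eq_zero hs0))
    have hγ0 : (γ r).im ≠ 0 :=
      norm_pos_iff.1 ((norm_pos_iff.2 hs0).trans_le (hγ r hr).2)
    rw [sigma_of_not_onSameLine]
    · exact (h1 r hr).2
    · intro h'
      exact h (OnSameLine.trans ⟨J, hJ, hsJ, (hγ r hr).1⟩ h' hγ0)

lemma mem_analyticSet_sigmaBall {p s : ℍ[ℝ]} {R : ℝ≥0∞} :
    s ∈ analyticSet Set.univ (sigmaBall p R) ↔
      ENNReal.ofReal (2 * ‖s.im‖ + sigma s p) < R := by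
  obtain ⟨γ, hγ⟩ := exists_isRay_sigma s p
  exact mem_analyticSet_iff (d := fun q => sigma q p) (by simp [sigmaBall]) trivial
    (fun q => sigma_nonneg q p) (fun t _ q _ => sigma_triangle t q p) hγ

lemma mem_analyticSet_omegaBall {p s : ℍ[ℝ]} {R : ℝ≥0∞} :
    s ∈ analyticSet Set.univ (omegaBall p R) ↔
      ENNReal.ofReal (2 * ‖s.im‖ + omega s p) < R := by
  obtain ⟨γ, hγ, -⟩ := exists_isRay_omega s p
  exact mem_analyticSet_iff (d := fun q => omega q p) (by simp [omegaBall]) trivial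
    (fun q => omega_nonneg q p) (fun t _ q _ => omega_le_sigma_add t q p) hγ

lemma mem_analyticSet_lineBall {I p s : ℍ[ℝ]} (hI : I ∈ imagUnits) (hp : p ∈ complexLine I)
    {R : ℝ≥0∞} : s ∈ analyticSet (complexLine I) (lineBall I p R) ↔
      s ∈ complexLine I ∧ ENNReal.ofReal (2 * ‖s.im‖ + ‖s - p‖) < R := by
  by_cases hs : s ∈ complexLine I
  · obtain ⟨γ, hγ⟩ := exists_isRay_line hI hp hs
    refine (mem_analyticSet_iff (d := fun q => ‖q - p‖) rfl hs (fun q => norm_nonneg _)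
      (fun t _ q _ => ?_) hγ).trans (by simp [hs])
    exact (norm_sub_le_norm_sub_add_norm_sub t q p).trans
      (by gcongr; exact norm_sub_le_sigma t q)
  · exact ⟨fun h => absurd h.1.1 hs, fun h => absurd h.1 hs⟩

lemma analyticSet_sigmaBall_eq {I p : ℍ[ℝ]} (hI : I ∈ imagUnits) (hp : p ∈ complexLine I)
    (R : ℝ≥0∞) : analyticSet Set.univ (sigmaBall p R) =
      analyticSet Set.univ (omegaBall p R) ∪ analyticSet (complexLine I) (lineBall I p R) := by
  ext s
  rw [Set.mem_union, mem_analyticSet_sigmaBall, mem_analyticSet_omegaBall,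
    mem_analyticSet_lineBall hI hp]
  constructor
  · intro h
    by_cases hs : s ∈ complexLine I
    · right; rw [sigma_of_mem hI hs hp] at h; exact ⟨hs, h⟩
    · left; rwa [sigma_of_not_mem hI hp hs] at h
  · rintro (h | ⟨hs, h⟩)
    · exact (ENNReal.ofReal_le_ofReal (by gcongr; exact sigma_le_omega s p)).trans_lt h
    · rwa [sigma_of_mem hI hs hp]

lemma analyticSet_sigmaBall_subset (p : ℍ[ℝ]) (R : ℝ≥0∞) :
    analyticSet Set.univ (sigmaBall p R) ⊆ omegaBall p R := by
  intro s hs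
  refine (ENNReal.ofReal_le_ofReal ((omega_le_norm_sub_add s p).trans ?_)).trans_lt
    (mem_analyticSet_sigmaBall.1 hs)
  rw [add_comm]; gcongr; exact norm_sub_le_sigma s p

/-- A complex line has empty interior. -/
lemma eq_empty_of_isOpen_of_subset_complexLine {I : ℍ[ℝ]} {U : Set ℍ[ℝ]} (hU : IsOpen U)
    (hUI : U ⊆ complexLine I) : U = ∅ := by
  refine Set.eq_empty_of_forall_notMem fun s hs => ?_
  have key : ∀ q : ℍ[ℝ], q ∈ complexLine I := by
    intro q
    have hcont : Tendsto (fun t : ℝ => s + q * (t : ℍ[ℝ])) (𝓝[>] 0) (𝓝 s) := by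
      have : Continuous fun t : ℝ => s + q * (t : ℍ[ℝ]) := by
        have := Quaternion.continuous_coe
        fun_prop
      simpa using (this.tendsto 0).mono_left nhdsWithin_le_nhds
    obtain ⟨t, ht, ht0⟩ := ((hcont.eventually (hU.mem_nhds hs)).and self_mem_nhdsWithin).exists
    obtain ⟨x, y, hxy⟩ := mem_complexLine_iff.1 (hUI ht)
    obtain ⟨x', y', hxy'⟩ := mem_complexLine_iff.1 (hUI hs)
    have ht0' : t ≠ 0 := ne_of_gt ht0
    refine ⟨(x - x') * t⁻¹, (y - y') * t⁻¹, ?_⟩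
    have e : q * (t : ℍ[ℝ]) = linePt I (x - x') (y - y') := by
      rw [← linePt_sub, ← hxy, ← hxy', add_sub_cancel_left]
    calc q = q * (t : ℍ[ℝ]) * ((t⁻¹ : ℝ) : ℍ[ℝ]) := by
          rw [mul_assoc, ← Quaternion.coe_mul, mul_inv_cancel₀ ht0', Quaternion.coe_one, mul_one]
      _ = _ := by rw [e, linePt, add_mul, mul_assoc, ← Quaternion.coe_mul, ← Quaternion.coe_mul]
  obtain ⟨i, hi0, hi1, hi2, hi3⟩ := exists_components 0 1 0 0
  obtain ⟨j, hj0, hj1, hj2, hj3⟩ := exists_components 0 0 1 0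
  obtain ⟨x, y, hi⟩ := mem_complexLine_iff.1 (key i)
  obtain ⟨x', y', hj⟩ := mem_complexLine_iff.1 (key j)
  have hcomm : i * j = j * i := by rw [hi, hj]; exact linePt_commute I x y x' y'
  have := congrArg (fun q : ℍ[ℝ] => q.imK) hcomm
  simp [hi0, hi1, hi2, hi3, hj0, hj1, hj2, hj3] at this
  linarith

lemma isOpen_analyticSet_of_im_eq_zero {p : ℍ[ℝ]} (hp : p.im = 0) (R : ℝ≥0∞) :
    IsOpen (analyticSet Set.univ (sigmaBall p R)) := by
  have : analyticSet Set.univ (sigmaBall p R) =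
      {s | ENNReal.ofReal (2 * ‖s.im‖ + omega s p) < R} := by
    ext s
    rw [mem_analyticSet_sigmaBall, sigma_of_im_eq_zero hp]; rfl
  rw [this]
  have h : Continuous fun q : ℍ[ℝ] => q.im := Quaternion.continuous_im
  exact isOpen_lt (ENNReal.continuous_ofReal.comp
    ((continuous_const.mul h.norm).add (continuous_omega p))) continuous_const

lemma not_isOpen_analyticSet {p : ℍ[ℝ]} (hp : p.im ≠ 0) {ρ : ℝ} (hρ : ‖p.im‖ < ρ) :
    ¬ IsOpen (analyticSet Set.univ (sigmaBall p (ENNReal.ofReal ρ))) := by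
  intro hopen
  obtain ⟨I, hI, hpI⟩ := exists_eq_linePt p
  have hm : 0 < ‖p.im‖ := norm_pos_iff.2 hp
  have hpmem : p ∈ complexLine I := ⟨_, _, hpI⟩
  have him : Continuous fun q : ℍ[ℝ] => q.im := Quaternion.continuous_im
  have hU : IsOpen {q : ℍ[ℝ] | ρ < 2 * ‖q.im‖ + omega q p} :=
    isOpen_lt continuous_const ((continuous_const.mul him.norm).add (continuous_omega p))
  have hmem : ∀ q, q ∈ analyticSet Set.univ (sigmaBall p (ENNReal.ofReal ρ)) ↔
      2 * ‖q.im‖ + sigma q p < ρ := fun q => by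
    have := sigma_nonneg q p
    rw [mem_analyticSet_sigmaBall, ENNReal.ofReal_lt_ofReal_iff_of_nonneg (by positivity)]
  have hempty := eq_empty_of_isOpen_of_subset_complexLine (I := I) (hopen.inter hU) <| by
    rintro q ⟨hq1, hq2⟩
    by_contra hq
    have hq3 := (hmem q).1 hq1
    rw [sigma_of_not_mem hI hpmem hq] at hq3
    exact lt_asymm hq2 hq3
  obtain ⟨v, hv1, hv2⟩ : ∃ v, (ρ - ‖p.im‖) / 3 < v ∧
      v < min (ρ - ‖p.im‖) ((ρ + ‖p.im‖) / 3) :=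
    exists_between (lt_min (by linarith) (by linarith))
  have hv3 := hv2.trans_le (min_le_left _ _)
  have hv4 := hv2.trans_le (min_le_right _ _)
  have hv0 : 0 < v := by linarith
  have hs : linePt I p.re v ∈
      analyticSet Set.univ (sigmaBall p (ENNReal.ofReal ρ)) ∩
        {q : ℍ[ℝ] | ρ < 2 * ‖q.im‖ + omega q p} := by
    have h1 : sigma (linePt I p.re v) p = |v - ‖p.im‖| := by
      rw [sigma_of_mem hI (linePt_mem ..) hpmem]
      nth_rewrite 2 [hpI]
      rw [linePt_sub, linePt_norm hI, sub_self, zero_pow two_ne_zero, zero_add,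
        Real.sqrt_sq_eq_abs]
    have h2 : omega (linePt I p.re v) p = v + ‖p.im‖ := by
      rw [omega, linePt_re hI, linePt_norm_im hI, abs_of_pos hv0, sub_self, zero_pow two_ne_zero,
        zero_add, Real.sqrt_sq (by positivity)]
    refine ⟨(hmem _).2 ?_, ?_⟩
    · rw [h1, linePt_norm_im hI, abs_of_pos hv0]
      have : |v - ‖p.im‖| < ρ - 2 * v := abs_lt.2 ⟨by linarith, by linarith⟩
      linarith
    · change ρ < _
      rw [h2, linePt_norm_im hI, abs_of_pos hv0]; linarith
  rw [hempty] at hs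
  exact hs

lemma isOpen_analyticSet_iff {p : ℍ[ℝ]} {R : ℝ≥0∞} (hne : (omegaBall p R).Nonempty) :
    IsOpen (analyticSet Set.univ (sigmaBall p R)) ↔ (∃ x : ℝ, p = (x : ℍ[ℝ])) ∨ R = ⊤ := by
  constructor
  · intro hopen
    by_contra! h
    obtain ⟨hp, hR⟩ := h
    have hp0 : p.im ≠ 0 := fun h0 => hp p.re <| by
      nth_rewrite 1 [← Quaternion.re_add_im p]
      rw [h0, add_zero]
    obtain ⟨q, hq⟩ := hne
    rw [← ENNReal.ofReal_toReal hR] at hopen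
    refine not_isOpen_analyticSet hp0 ?_ hopen
    change ENNReal.ofReal _ < R at hq
    rw [ENNReal.ofReal_lt_iff_lt_toReal (omega_nonneg q p) hR] at hq
    refine lt_of_le_of_lt ?_ hq
    refine Real.le_sqrt_of_sq_le ?_
    nlinarith [norm_nonneg q.im, norm_nonneg p.im, sq_nonneg (q.re - p.re)]
  · rintro (⟨x, rfl⟩ | rfl)
    · exact isOpen_analyticSet_of_im_eq_zero (by simp) R
    · convert isOpen_univ
      ext s
      simp [mem_analyticSet_sigmaBall, ENNReal.ofReal_lt_top]

end QuatSeries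

end

theorem mainTheorem10 (p I : ℍ[ℝ]) (hI : I ∈ QuatSeries.imagUnits)
    (hp : p ∈ QuatSeries.complexLine I) (a : ℕ → ℍ[ℝ]) (R : ℝ≥0∞)
    (hR : R = QuatSeries.sigmaRadius a) (hne : (QuatSeries.omegaBall p R).Nonempty) :
    (∀ q ∈ QuatSeries.sigmaBall p R, Summable fun n => ‖QuatSeries.starPow p n q * a n‖) ∧
    QuatSeries.analyticSet Set.univ (QuatSeries.sigmaBall p R) =
      QuatSeries.analyticSet Set.univ (QuatSeries.omegaBall p R) ∪
        QuatSeries.analyticSet (QuatSeries.complexLine I) (QuatSeries.lineBall I p R) ∧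
    (∀ s ∈ QuatSeries.analyticSet Set.univ (QuatSeries.sigmaBall p R),
      QuatSeries.QuaternionicAnalyticAt (QuatSeries.seriesSum p a)
        (QuatSeries.omegaBall p R) s) ∧
    QuatSeries.analyticSet Set.univ (QuatSeries.sigmaBall p R) ⊆ QuatSeries.omegaBall p R ∧
    (IsOpen (QuatSeries.analyticSet Set.univ (QuatSeries.sigmaBall p R)) ↔
      (∃ x : ℝ, p = (x : ℍ[ℝ])) ∨ R = ⊤) := by
  refine ⟨fun q hq => ?_, QuatSeries.analyticSet_sigmaBall_eq hI hp R, fun s hs => ?_,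
    QuatSeries.analyticSet_sigmaBall_subset p R, QuatSeries.isOpen_analyticSet_iff hne⟩
  · subst hR
    exact QuatSeries.summable_starPow hq
  · have hs' := QuatSeries.mem_analyticSet_sigmaBall.1 hs
    subst hR
    exact QuatSeries.quaternionicAnalyticAt_seriesSum hs'
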